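/- **Theorem (Strongly contracting monotone systems).** Let $n\ge 1$ and order $\mathbb{R}^n$ componentwise. Let $f:\mathbb{R}_{\ge 0}\times\mathbb{R}^n\to\mathbb{R}^n$ be continuous, differentiable in $x$, with Jacobian $Df(t,x)$ (derivative in $x$) continuous in $(t,x)$. Let $C\subseteq\mathbb{R}^n$ be convex, and suppose that for all $t_0\ge 0$, $x_0\in C$ the solution $t\mapsto\phi(t,t_0,x_0)$ of $\dot x=f(t,x)$, $x(t_0)=x_0$, exists and lies in $C$ for all $t\ge t_0$ ($C$ is forward invariant), and that $\phi(t,t_0,x_0)\le\phi(t,t_0,y_0)$ for all $t\ge t_0\ge 0$ and all $x_0,y_0\in C$ with $x_0\le y_0$ (the system is monotone on $C$). Let $\|\cdot\|$ be a norm on $\mathbb{R}^n$ and $[\![\cdot,\cdot]\!]:\mathbb{R}^n\times\mathbb{R}^n\to\mathbb{R}$ an associated weak pairing, that is: $[\![x_1+x_2,y]\!]\le[\![x_1,y]\!]+[\![x_2,y]\!]$; $[\![\cdot,y]\!]$ is continuous; $[\![\alpha x,y]\!]=[\![x,\alpha y]\!]=\alpha[\![x,y]\!]$ for $\alpha\ge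 0$ and $[\![-x,-y]\!]=[\![x,y]\!]$; $[\![x,x]\!]>0$ for $x\neq 0$; $|[\![x,y]\!]|\le[\![x,x]\!]^{1/2}[\![y,y]\!]^{1/2}$; and $[\![x,x]\!]=\|x\|^2$. Assume Deimling's inequality: $[\![x,y]\!]\le\|y\|\lim_{h\to 0^+}\frac{\|y+hx\|-\|y\|}{h}$ for all $x,y$. The conic matrix measure of $A\in\mathbb{R}^{n\times n}$ is $$\mu^+(A)=\lim_{h\to 0^+}\ \sup_{x\ge 0,\ x\ne 0}\frac{\|(I_n+hA)x\|/\|x\|-1}{h}.$$ The norm is *monotonic* if $|x|\le|y|$ (componentwise absolute values) implies $\|x\|\le\|y\|$. $D^+$ denotes the upper right Dini derivative in $t$. Let $b\in\mathbb{R}$ and consider the conditions 1. $\mu^+(Df(t,x))\le b$ for all $t\ge 0$, $x\in C$; 2. $[\![f(t,x)-f(t,y),x-y]\!]\le b\|x-y\|^2$ for all $t\ge 0$ and $x,y\in C$ with $x\ge y$; 3. $D^+\|\phi(t,t_0,x_0)-\phi(t,t_0,y_0)\|\le b\,\|\phi(t,t_0,x_0)-\phi(t,t_0,y_0)\|$ for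 all $t\ge t_0\ge 0$ and $x_0,y_0\in C$; 4. $\|\phi(t,t_0,x_0)-\phi(t,t_0,y_0)\|\le e^{b(t-s)}\|\phi(s,t_0,x_0)-\phi(s,t_0,y_0)\|$ for all $0\le t_0\le s\le t$ and $x_0,y_0\in C$. Then: (a) If $C$ has nonempty interior and $\|\cdot\|$ is monotonic, conditions 1, 2, 3, 4 are equivalent. (b) If $C$ has nonempty interior, then for an arbitrary norm (monotonic or not) conditions 1 and 2 are equivalent. (c) If $C=[x_{\min},x_{\max}]=\{z:x_{\min}\le z\le x_{\max}\}$ with $x_{\min}\le x_{\max}$, $x_{\min}\ne x_{\max}$, then for an arbitrary norm each of conditions 1 and 2 implies that there is $M>0$ such that, for all $x_0,y_0\in[x_{\min},x_{\max}]$ and all $0\le t_0\le s\le t$, $$\|\phi(t,t_0,x_0)-\phi(t,t_0,y_0)\|\le M e^{b(t-s)}\|\phi(s,t_0,x_0)-\phi(s,t_0,y_0)\|.$$ -/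

import Mathlib

open Filter Topology

/-! Norms on `ℝⁿ` are represented by seminorms `N` on `Fin n → ℝ` that vanish only at `0`; the
order on `Fin n → ℝ` is the componentwise one. -/

/-- The norm `N` is monotonic: `|x| ≤ |y|` componentwise implies `N x ≤ N y`. -/
def IsMonotonicNorm {n : ℕ} (N : Seminorm ℝ (Fin n → ℝ)) : Prop :=
  ∀ x y : Fin n → ℝ, (∀ i, |x i| ≤ |y i|) → N x ≤ N y

/-- Weak pairings on `ℝⁿ`. -/
structure IsWeakPairing {n : ℕ} (W : (Fin n → ℝ) → (Fin n → ℝ) → ℝ) : Prop where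
  add_le : ∀ x₁ x₂ y, W (x₁ + x₂) y ≤ W x₁ y + W x₂ y
  continuous_left : ∀ y, Continuous fun x => W x y
  smul_left : ∀ (α : ℝ) (x y), 0 ≤ α → W (α • x) y = α * W x y
  smul_right : ∀ (α : ℝ) (x y), 0 ≤ α → W x (α • y) = α * W x y
  neg_neg : ∀ x y, W (-x) (-y) = W x y
  pos : ∀ x, x ≠ 0 → 0 < W x x
  abs_le : ∀ x y, |W x y| ≤ √(W x x) * √(W y y)

/-- The weak pairing `W` is associated with the norm `N`. -/
def IsAssociatedPairing {n : ℕ} (N : Seminorm ℝ (Fin n → ℝ))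
    (W : (Fin n → ℝ) → (Fin n → ℝ) → ℝ) : Prop :=
  ∀ x, N x ^ 2 = W x x

/-- Deimling's inequality: `W x y ≤ N y * lim_{h → 0⁺} (N (y + h x) - N y) / h`
(the limit always exists, by convexity of `N`). -/
def DeimlingInequality {n : ℕ} (N : Seminorm ℝ (Fin n → ℝ))
    (W : (Fin n → ℝ) → (Fin n → ℝ) → ℝ) : Prop :=
  ∀ x y, ∃ d : ℝ,
    Tendsto (fun h : ℝ => (N (y + h • x) - N y) / h) (𝓝[>] 0) (𝓝 d) ∧ W x y ≤ N y * d

/-- The supremum over nonzero `x ≥ 0` of `(‖(I + h A) x‖ / ‖x‖ - 1) / h`. -/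
noncomputable def conicQuotient {n : ℕ} (N : Seminorm ℝ (Fin n → ℝ))
    (A : Matrix (Fin n) (Fin n) ℝ) (h : ℝ) : ℝ :=
  ⨆ x : {x : Fin n → ℝ // 0 ≤ x ∧ x ≠ 0}, (N ((1 + h • A).mulVec x.1) / N x.1 - 1) / h

/-- The conic matrix measure `μ⁺(A)`: the limit of `conicQuotient N A h` as `h → 0⁺`. -/
noncomputable def conicMatrixMeasure {n : ℕ} (N : Seminorm ℝ (Fin n → ℝ))
    (A : Matrix (Fin n) (Fin n) ℝ) : ℝ :=
  limUnder (𝓝[>] 0) (conicQuotient N A)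

/-- The Jacobian matrix of `f (t, ·)` at `x`. -/
noncomputable def jacobianMatrix {n : ℕ} (f : ℝ → (Fin n → ℝ) → (Fin n → ℝ)) (t : ℝ)
    (x : Fin n → ℝ) : Matrix (Fin n) (Fin n) ℝ :=
  LinearMap.toMatrix' (fderiv ℝ (f t) x : (Fin n → ℝ) →ₗ[ℝ] (Fin n → ℝ))

/-- `φ t t₀ x₀` is the flow of `x' = f (t, x)` at time `t`, started at time `t₀ ≥ 0` from `x₀ ∈ C`;
it is defined for all `t ≥ t₀`. -/
def IsFlowOn {n : ℕ} (f : ℝ → (Fin n → ℝ) → (Fin n → ℝ)) (C : Set (Fin n → ℝ))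
    (φ : ℝ → ℝ → (Fin n → ℝ) → (Fin n → ℝ)) : Prop :=
  ∀ t₀, 0 ≤ t₀ → ∀ x₀ ∈ C, φ t₀ t₀ x₀ = x₀ ∧
    ∀ t, t₀ ≤ t → HasDerivWithinAt (fun s => φ s t₀ x₀) (f t (φ t t₀ x₀)) (Set.Ici t₀) t

/-- `C` is forward invariant under `φ`. -/
def IsForwardInvariantSet {n : ℕ} (φ : ℝ → ℝ → (Fin n → ℝ) → (Fin n → ℝ))
    (C : Set (Fin n → ℝ)) : Prop :=
  ∀ t₀, 0 ≤ t₀ → ∀ x₀ ∈ C, ∀ t, t₀ ≤ t → φ t t₀ x₀ ∈ C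

/-- The system with flow `φ` is monotone on `C`. -/
def IsMonotoneFlowOn {n : ℕ} (φ : ℝ → ℝ → (Fin n → ℝ) → (Fin n → ℝ))
    (C : Set (Fin n → ℝ)) : Prop :=
  ∀ t₀, 0 ≤ t₀ → ∀ x₀ ∈ C, ∀ y₀ ∈ C, x₀ ≤ y₀ → ∀ t, t₀ ≤ t → φ t t₀ x₀ ≤ φ t t₀ y₀

/-- The upper right Dini derivative `D⁺ g (t)`, as an extended real number. -/
noncomputable def upperRightDini (g : ℝ → ℝ) (t : ℝ) : EReal :=
  limsup (fun h : ℝ => (((g (t + h) - g t) / h : ℝ) : EReal)) (𝓝[>] 0)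

/-- `μ⁺(Df(t, x)) ≤ b` for all `t ≥ 0` and `x ∈ C`. -/
def ConicJacobianBound {n : ℕ} (N : Seminorm ℝ (Fin n → ℝ))
    (f : ℝ → (Fin n → ℝ) → (Fin n → ℝ)) (C : Set (Fin n → ℝ)) (b : ℝ) : Prop :=
  ∀ t, 0 ≤ t → ∀ x ∈ C, conicMatrixMeasure N (jacobianMatrix f t x) ≤ b

/-- `⟦f(t, x) - f(t, y), x - y⟧ ≤ b ‖x - y‖²` for all `t ≥ 0` and all `x, y ∈ C` with `x ≥ y`. -/
def OrderedOneSidedLipschitz {n : ℕ} (N : Seminorm ℝ (Fin n → ℝ))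
    (W : (Fin n → ℝ) → (Fin n → ℝ) → ℝ)
    (f : ℝ → (Fin n → ℝ) → (Fin n → ℝ)) (C : Set (Fin n → ℝ)) (b : ℝ) : Prop :=
  ∀ t, 0 ≤ t → ∀ x ∈ C, ∀ y ∈ C, y ≤ x → W (f t x - f t y) (x - y) ≤ b * N (x - y) ^ 2

theorem exists_norm_mulVec_le {n : ℕ} (N : Seminorm ℝ (Fin n → ℝ)) (hN : ∀ x, N x = 0 → x = 0)
    (A : Matrix (Fin n) (Fin n) ℝ) : ∃ K : ℝ, ∀ x, N (A.mulVec x) ≤ K * N x := by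
  have hbd : ∀ x, N x ≤ (∑ i, N (Pi.single i 1)) * ‖x‖ := by
    intro x
    calc N x = N (∑ i, x i • (Pi.single i 1 : Fin n → ℝ)) := by
          congr 1; ext j; simp [Finset.sum_apply, Pi.single_apply]
      _ ≤ ∑ i, N (x i • (Pi.single i 1 : Fin n → ℝ)) :=
          Finset.le_sum_of_subadditive N (map_zero N).le (map_add_le_add N) _ _
      _ ≤ ∑ i, N (Pi.single i 1) * ‖x‖ := by
          apply Finset.sum_le_sum; intro i _
          rw [map_smul_eq_mul, mul_comm]
          exact mul_le_mul_of_nonneg_left (norm_le_pi_norm x i) (apply_nonneg _ _)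
      _ = _ := by rw [Finset.sum_mul]
  have hS0 : 0 ≤ ∑ i, N (Pi.single i (1 : ℝ)) := Finset.sum_nonneg fun i _ => apply_nonneg _ _
  have hc : Continuous N := by
    apply Seminorm.continuous (r := 1)
    refine Filter.mem_of_superset (Metric.ball_mem_nhds 0
      (ε := 1 / ((∑ i, N (Pi.single i (1 : ℝ))) + 1)) (by positivity)) ?_
    intro x hx
    rw [mem_ball_zero_iff, lt_div_iff₀ (by positivity)] at hx
    rw [Seminorm.mem_ball_zero]
    nlinarith [hbd x, norm_nonneg x]
  have hK : ∃ c : ℝ, 0 ≤ c ∧ ∀ x, ‖x‖ ≤ c * N x := by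
    rcases (Metric.sphere (0 : Fin n → ℝ) 1).eq_empty_or_nonempty with he | hne
    · refine ⟨0, le_rfl, fun x => ?_⟩
      by_contra h
      have hx : ‖x‖ ≠ 0 := by intro h0; apply h; simp [h0]
      have : (‖x‖⁻¹ • x) ∈ Metric.sphere (0 : Fin n → ℝ) 1 := by
        simp [norm_smul, hx]
      simp [he] at this
    · obtain ⟨z, hz, hmin⟩ := (isCompact_sphere (0 : Fin n → ℝ) 1).exists_isMinOn hne
        hc.continuousOn
      have hzp : 0 < N z := lt_of_le_of_ne (apply_nonneg _ _) fun h => by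
        simp [hN z h.symm] at hz
      refine ⟨(N z)⁻¹, by positivity, fun x => ?_⟩
      by_cases hx : ‖x‖ = 0
      · rw [hx]; have := apply_nonneg N x; positivity
      have : (‖x‖⁻¹ • x) ∈ Metric.sphere (0 : Fin n → ℝ) 1 := by
        simp [norm_smul, hx]
      have h2 := hmin this
      simp only [map_smul_eq_mul, norm_inv, norm_norm, Set.mem_ofPred_eq] at h2
      have hxp : 0 < ‖x‖ := lt_of_le_of_ne (norm_nonneg _) (Ne.symm hx)
      rw [inv_mul_eq_div, le_div_iff₀ hxp] at h2
      rw [inv_mul_eq_div, le_div_iff₀ hzp]; linarith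
  obtain ⟨c, hc0, hcb⟩ := hK
  obtain ⟨L, hL0, hL⟩ := (LinearMap.toContinuousLinearMap A.mulVecLin).bound
  refine ⟨(∑ i, N (Pi.single i 1)) * (L * c), fun x => ?_⟩
  calc _ ≤ _ := hbd _
    _ ≤ (∑ i, N (Pi.single i 1)) * (L * (c * N x)) := by
      apply mul_le_mul_of_nonneg_left _ hS0
      exact (hL x).trans (mul_le_mul_of_nonneg_left (hcb x) hL0.le)
    _ = _ := by ring

/-- The limit that defines the conic matrix measure exists. -/
theorem tendsto_conicQuotient {n : ℕ} (N : Seminorm ℝ (Fin n → ℝ)) (hN : ∀ x, N x = 0 → x = 0)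
    (A : Matrix (Fin n) (Fin n) ℝ) :
    Tendsto (conicQuotient N A) (𝓝[>] 0) (𝓝 (conicMatrixMeasure N A)) := by
  obtain ⟨K, hK⟩ := exists_norm_mulVec_le N hN A
  apply tendsto_nhds_limUnder
  have hpos : ∀ x : {x : Fin n → ℝ // 0 ≤ x ∧ x ≠ 0}, 0 < N x.1 := fun x =>
    lt_of_le_of_ne (apply_nonneg _ _) fun h => x.2.2 (hN _ h.symm)
  have hvec : ∀ (h : ℝ) (x : Fin n → ℝ), (1 + h • A).mulVec x = x + h • A.mulVec x := by
    intro h x; rw [Matrix.add_mulVec, Matrix.one_mulVec, Matrix.smul_mulVec]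
  have hub : ∀ h : ℝ, 0 < h → ∀ x : {x : Fin n → ℝ // 0 ≤ x ∧ x ≠ 0},
      (N ((1 + h • A).mulVec x.1) / N x.1 - 1) / h ≤ K := by
    intro h hh x
    have h1 := map_add_le_add N x.1 (h • A.mulVec x.1)
    rw [map_smul_eq_mul, Real.norm_of_nonneg hh.le] at h1
    rw [div_le_iff₀ hh, sub_le_iff_le_add, div_le_iff₀ (hpos x), hvec]
    nlinarith [hK x.1]
  have hlb : ∀ h : ℝ, 0 < h → ∀ x : {x : Fin n → ℝ // 0 ≤ x ∧ x ≠ 0},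
      -K ≤ (N ((1 + h • A).mulVec x.1) / N x.1 - 1) / h := by
    intro h hh x
    have h1 := map_sub_le_add N (x.1 + h • A.mulVec x.1) (h • A.mulVec x.1)
    rw [map_smul_eq_mul, Real.norm_of_nonneg hh.le, add_sub_cancel_right] at h1
    rw [le_div_iff₀ hh, le_sub_iff_add_le, le_div_iff₀ (hpos x), hvec]
    nlinarith [hK x.1]
  have hbdd : ∀ h : ℝ, 0 < h → BddAbove (Set.range fun x : {x : Fin n → ℝ // 0 ≤ x ∧ x ≠ 0} =>
      (N ((1 + h • A).mulVec x.1) / N x.1 - 1) / h) := fun h hh =>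
    ⟨K, by rintro _ ⟨x, rfl⟩; exact hub h hh x⟩
  rcases isEmpty_or_nonempty {x : Fin n → ℝ // 0 ≤ x ∧ x ≠ 0} with he | hne
  · refine ⟨0, ?_⟩
    have : conicQuotient N A = fun _ => 0 := by
      funext h; exact Real.iSup_of_isEmpty _
    rw [this]; exact tendsto_const_nhds
  have hmono : MonotoneOn (conicQuotient N A) (Set.Ioi 0) := by
    intro h hh k hk hhk
    have hh' : 0 < h := hh
    have hk' : 0 < k := hk
    apply ciSup_mono (hbdd k hk)
    intro x
    have e : x.1 + h • A.mulVec x.1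
        = (1 - h / k) • x.1 + (h / k) • (x.1 + k • A.mulVec x.1) := by
      rw [smul_add, smul_smul, div_mul_cancel₀ _ hk'.ne', sub_smul, one_smul]; abel
    have hq : h / k ≤ 1 := (div_le_one hk').2 hhk
    have h1 := map_add_le_add N ((1 - h / k) • x.1) ((h / k) • (x.1 + k • A.mulVec x.1))
    rw [← e, map_smul_eq_mul, map_smul_eq_mul, Real.norm_of_nonneg (by linarith),
      Real.norm_of_nonneg (by positivity)] at h1
    have hp := hpos x
    simp only [hvec]
    rw [div_le_div_iff₀ hh' hk', div_sub_one hp.ne', div_sub_one hp.ne', div_mul_eq_mul_div,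
      div_mul_eq_mul_div]
    apply div_le_div_of_nonneg_right _ hp.le
    have : N (x.1 + h • A.mulVec x.1) * k
        ≤ ((1 - h / k) * N x.1 + h / k * N (x.1 + k • A.mulVec x.1)) * k :=
      mul_le_mul_of_nonneg_right h1 hk'.le
    have e2 : ((1 - h / k) * N x.1 + h / k * N (x.1 + k • A.mulVec x.1)) * k
        = (k - h) * N x.1 + h * N (x.1 + k • A.mulVec x.1) := by
      field_simp
    rw [e2] at this
    linarith
  have hbelow : BddBelow (conicQuotient N A '' Set.Ioi 0) := by
    refine ⟨-K, ?_⟩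
    rintro _ ⟨h, hh, rfl⟩
    obtain ⟨x⟩ := hne
    exact (hlb h hh x).trans (le_ciSup (hbdd h hh) x)
  exact ⟨_, MonotoneOn.tendsto_nhdsGT hmono hbelow⟩

/-!
Write `D(v; w)` for the right derivative of `h ↦ N (v + h w)` at `0` (`normDirDeriv`). It is
sublinear in `w`, and along a differentiable curve `u` it gives the right derivative
`D(u; u')` and the left derivative `-D(u; -u')` of `N u`.

*Increments and Jacobians.* If `q` is sublinear, then by Hahn–Banach some linear `p ≤ q` agrees with
`q` at `f (t, x) - f (t, y)`; the mean value theorem for `p ∘ f (t, ·)` then bounds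
`q (f (t, x) - f (t, y))` by the values of `q` at the vectors `Df (t, z) (x - y)`, with `z` on the
segment (`sublinear_sub_le_of_fderiv_le`). Taking `q = ⟦·, x - y⟧` and using Deimling's inequality,
the bound on `μ⁺(Df)` yields the one-sided Lipschitz condition on ordered pairs, on any convex `C`.

*The converse.* Monotonicity forces `Df (t, x)` to be a Metzler matrix `A` on the interior of `C`,
hence on `C` (`jacobianMatrix_metzler`), and difference quotients of the one-sided Lipschitz
condition give `⟦A v, v⟧ ≤ b ‖v‖²` for `v ≥ 0`. As `1 + h A` preserves the cone for small `h`, this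
applies to `z = (1 + h A) v`, and
`(1 - h b) ‖z‖ ≤ ‖(1 - h A) z‖ = ‖v - h² A² v‖ ≤ (1 + O(h²)) ‖v‖` gives `μ⁺(A) ≤ b`
(`conicMatrixMeasure_le`).

*Monotonic norms.* Here `‖(1 + h A) v‖ ≤ ‖(1 + h A) |v|‖` for Metzler `A` and small `h`, so `μ⁺(A)`
controls `D(v; A v)` for every `v`, and `q = D(v; ·)` in the mean value inequality bounds the growth
rate of the distance of any two trajectories. Grönwall's inequality integrates this bound, and
differentiating the exponential estimate at the initial time returns the one-sided Lipschitz
condition.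

*Boxes.* For an arbitrary norm, ordered trajectories satisfy the exponential estimate with constant
`1` (`OrderedOneSidedLipschitz.norm_flow_sub_le`). Two arbitrary points `X`, `Y` of a box are both
comparable with `X ⊓ Y`, which is in the box; the triangle inequality and the equivalence of norms
give the constant `M`. The estimate may be started at any intermediate time because solutions are
unique (`IsFlowOn.flow_flow`).
-/

/-! ### Directional derivatives of a seminorm -/

section SeminormDirectionalDerivative

variable {E : Type*} [AddCommGroup E] [Module ℝ E]

/-- The right derivative of `h ↦ N (y + h x)` at `h = 0`. The limit always exists, see
`tendsto_normDirDeriv`. -/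
noncomputable def normDirDeriv (N : Seminorm ℝ E) (y x : E) : ℝ :=
  limUnder (𝓝[>] 0) fun h : ℝ => (N (y + h • x) - N y) / h

theorem tendsto_normDirDeriv (N : Seminorm ℝ E) (y x : E) :
    Tendsto (fun h : ℝ => (N (y + h • x) - N y) / h) (𝓝[>] 0) (𝓝 (normDirDeriv N y x)) := by
  apply tendsto_nhds_limUnder
  -- convexity makes the difference quotient monotone in `h`
  have hmono : MonotoneOn (fun h : ℝ => (N (y + h • x) - N y) / h) (Set.Ioi 0) := by
    intro h hh k hk hhk
    have hh' : 0 < h := hh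
    have hk' : 0 < k := hk
    have e : k • (y + h • x) = (k - h) • y + h • (y + k • x) := by module
    have h1 := map_add_le_add N ((k - h) • y) (h • (y + k • x))
    rw [← e, map_smul_eq_mul, map_smul_eq_mul, map_smul_eq_mul, Real.norm_of_nonneg hk'.le,
      Real.norm_of_nonneg hh'.le, Real.norm_of_nonneg (by linarith)] at h1
    dsimp only
    rw [div_le_div_iff₀ hh' hk']
    linarith
  have hbelow : BddBelow ((fun h : ℝ => (N (y + h • x) - N y) / h) '' Set.Ioi 0) := by
    refine ⟨-N x, ?_⟩
    rintro _ ⟨h, hh, rfl⟩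
    have hh' : 0 < h := hh
    have h1 := map_sub_le_add N (y + h • x) (h • x)
    rw [add_sub_cancel_right, map_smul_eq_mul, Real.norm_of_nonneg hh'.le] at h1
    dsimp only
    rw [le_div_iff₀ hh']
    linarith
  exact ⟨_, MonotoneOn.tendsto_nhdsGT hmono hbelow⟩

theorem normDirDeriv_smul (N : Seminorm ℝ E) (y : E) (c : ℝ) (hc : 0 < c) (x : E) :
    normDirDeriv N y (c • x) = c * normDirDeriv N y x := by
  have hs : Tendsto (fun h : ℝ => h * c) (𝓝[>] 0) (𝓝[>] 0) := by
    refine tendsto_nhdsWithin_iff.2 ⟨?_, ?_⟩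
    · have : Tendsto (fun h : ℝ => h * c) (𝓝 0) (𝓝 (0 * c)) := tendsto_id.mul_const c
      rw [zero_mul] at this
      exact this.mono_left nhdsWithin_le_nhds
    · filter_upwards [self_mem_nhdsWithin] with h hh using mul_pos hh hc
  refine tendsto_nhds_unique (tendsto_normDirDeriv N y (c • x))
    ((((tendsto_normDirDeriv N y x).comp hs).const_mul c).congr fun h => ?_)
  simp only [Function.comp, smul_smul]
  rw [mul_comm h c, ← mul_div_assoc, mul_div_mul_left _ _ hc.ne']

theorem normDirDeriv_add_le (N : Seminorm ℝ E) (y x₁ x₂ : E) :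
    normDirDeriv N y (x₁ + x₂) ≤ normDirDeriv N y x₁ + normDirDeriv N y x₂ := by
  have h2 : normDirDeriv N y x₁ + normDirDeriv N y x₂
      = (normDirDeriv N y ((2 : ℝ) • x₁) + normDirDeriv N y ((2 : ℝ) • x₂)) / 2 := by
    rw [normDirDeriv_smul N y 2 two_pos, normDirDeriv_smul N y 2 two_pos]; ring
  -- `y + h (x₁ + x₂)` is the midpoint of `y + 2 h x₁` and `y + 2 h x₂`
  rw [h2]
  refine le_of_tendsto_of_tendsto (tendsto_normDirDeriv N y (x₁ + x₂))
    (((tendsto_normDirDeriv N y ((2 : ℝ) • x₁)).add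
      (tendsto_normDirDeriv N y ((2 : ℝ) • x₂))).div_const 2) ?_
  filter_upwards [self_mem_nhdsWithin] with h hh
  have hh' : 0 < h := hh
  have e : (2 : ℝ) • (y + h • (x₁ + x₂))
      = (y + h • (2 : ℝ) • x₁) + (y + h • (2 : ℝ) • x₂) := by module
  have h1 := map_add_le_add N (y + h • (2 : ℝ) • x₁) (y + h • (2 : ℝ) • x₂)
  rw [← e, map_smul_eq_mul, Real.norm_of_nonneg two_pos.le] at h1
  rw [← add_div, div_div, div_le_div_iff₀ hh' (by positivity)]
  nlinarith

end SeminormDirectionalDerivative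

/-! ### A mean value inequality for sublinear functions -/

section Sublinear

/-- Hahn–Banach: a sublinear function is, at each point, attained by a linear functional that it
dominates. -/
theorem exists_linearMap_le_sublinear_eq {E : Type*} [AddCommGroup E] [Module ℝ E] (q : E → ℝ)
    (q_smul : ∀ c : ℝ, 0 < c → ∀ x, q (c • x) = c * q x)
    (q_add : ∀ x y, q (x + y) ≤ q x + q y) (w : E) :
    ∃ p : E →ₗ[ℝ] ℝ, (∀ x, p x ≤ q x) ∧ p w = q w := by
  have q_0 : q 0 = 0 := by
    have := q_smul 2 two_pos 0
    rw [smul_zero] at this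
    linarith
  have H : ∀ c : ℝ, c • w = 0 → (RingHom.id ℝ c) • q w = 0 := by
    intro c hc
    rcases smul_eq_zero.1 hc with h | h
    · simp [h]
    · simp [h, q_0]
  have hle : ∀ x : (LinearPMap.mkSpanSingleton' w (q w) H).domain,
      LinearPMap.mkSpanSingleton' w (q w) H x ≤ q x := by
    rintro ⟨x, hx⟩
    obtain ⟨c, rfl⟩ := Submodule.mem_span_singleton.1 hx
    rw [LinearPMap.mkSpanSingleton'_apply]
    simp only [RingHom.id_apply, smul_eq_mul]
    rcases lt_trichotomy c 0 with hc | hc | hc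
    · have h1 := q_add (c • w) ((-c) • w)
      rw [← add_smul, add_neg_cancel, zero_smul, q_0, q_smul (-c) (by linarith)] at h1
      linarith
    · simp [hc, q_0]
    · exact (q_smul c hc w).ge
  obtain ⟨p, hp, hpq⟩ := exists_extension_of_le_sublinear _ q q_smul q_add hle
  exact ⟨p, hpq, (hp ⟨w, Submodule.mem_span_singleton_self w⟩).trans
    (LinearPMap.mkSpanSingleton'_apply_self w (q w) H _)⟩

/-- Mean value inequality for a sublinear function `q` of an increment. -/
theorem sublinear_sub_le_of_fderiv_le {E F : Type*} [NormedAddCommGroup E] [NormedSpace ℝ E]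
    [NormedAddCommGroup F] [NormedSpace ℝ F] [FiniteDimensional ℝ F] {q : F → ℝ}
    (q_smul : ∀ c : ℝ, 0 < c → ∀ x, q (c • x) = c * q x)
    (q_add : ∀ x y, q (x + y) ≤ q x + q y) {C : Set E} (hC : Convex ℝ C) {g : E → F}
    (hg : Differentiable ℝ g) {x y : E} (hx : x ∈ C) (hy : y ∈ C) {B : ℝ}
    (hB : ∀ z ∈ C, q (fderiv ℝ g z (x - y)) ≤ B) : q (g x - g y) ≤ B := by
  obtain ⟨p, hpq, hp⟩ := exists_linearMap_le_sublinear_eq q q_smul q_add (g x - g y)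
  obtain ⟨z, hz, hzp⟩ := domain_mvt (f := fun z => p.toContinuousLinearMap (g z))
    (f' := fun z => p.toContinuousLinearMap ∘L fderiv ℝ g z)
    (fun z _ => (p.toContinuousLinearMap.hasFDerivAt.comp z
      (hg z).hasFDerivAt).hasFDerivWithinAt) hC hy hx
  have hzC : z ∈ C := hC.segment_subset hy hx hz
  rw [← map_sub] at hzp
  calc q (g x - g y) = p (g x - g y) := hp.symm
    _ = p (fderiv ℝ g z (x - y)) := hzp
    _ ≤ q (fderiv ℝ g z (x - y)) := hpq _
    _ ≤ B := hB z hzC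

end Sublinear

/-! ### Norms along curves in finite dimension -/

section FiniteDimensionalSeminorm

variable {E : Type*} [NormedAddCommGroup E] [NormedSpace ℝ E] [FiniteDimensional ℝ E]

theorem Seminorm.continuous_of_finiteDimensional (N : Seminorm ℝ E) : Continuous N :=
  N.convexOn.locallyLipschitz.continuous

theorem Seminorm.exists_le_mul_norm (N : Seminorm ℝ E) :
    ∃ K, 0 < K ∧ ∀ x, N x ≤ K * ‖x‖ :=
  N.bound_of_continuous_normedSpace N.continuous_of_finiteDimensional

theorem Seminorm.exists_norm_le_mul (N : Seminorm ℝ E) (hN : ∀ x, N x = 0 → x = 0) :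
    ∃ c, 0 < c ∧ ∀ x, ‖x‖ ≤ c * N x := by
  rcases subsingleton_or_nontrivial E with h | h
  · exact ⟨1, one_pos, fun x => by simp [Subsingleton.elim x 0]⟩
  have : ProperSpace E := FiniteDimensional.proper ℝ E
  obtain ⟨z, hz, hmin⟩ := (isCompact_sphere (0 : E) 1).exists_isMinOn
    (NormedSpace.sphere_nonempty.2 zero_le_one) N.continuous_of_finiteDimensional.continuousOn
  have hzp : 0 < N z := lt_of_le_of_ne (apply_nonneg _ _) fun h => by
    simp [hN z h.symm] at hz
  refine ⟨(N z)⁻¹, by positivity, fun x => ?_⟩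
  by_cases hx : x = 0
  · simp [hx]
  have hxp : 0 < ‖x‖ := norm_pos_iff.2 hx
  have h2 : N z ≤ N (‖x‖⁻¹ • x) := hmin (by simp [norm_smul, hx])
  rw [map_smul_eq_mul, norm_inv, norm_norm, inv_mul_eq_div, le_div_iff₀ hxp] at h2
  rw [inv_mul_eq_div, le_div_iff₀ hzp]
  linarith

/-- The right derivative of the norm along a curve `u` that has a right derivative. -/
theorem tendsto_norm_slope_right (N : Seminorm ℝ E) {u : ℝ → E} {w : E} {t : ℝ}
    (hu : HasDerivWithinAt u w (Set.Ici t) t) :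
    Tendsto (fun h : ℝ => (N (u (t + h)) - N (u t)) / h) (𝓝[>] 0)
      (𝓝 (normDirDeriv N (u t) w)) := by
  obtain ⟨K, hK0, hK⟩ := N.exists_le_mul_norm
  have hshift : Tendsto (fun h : ℝ => t + h) (𝓝[>] 0) (𝓝[>] t) := by
    refine tendsto_nhdsWithin_iff.2 ⟨?_, ?_⟩
    · have : Tendsto (fun h : ℝ => t + h) (𝓝 0) (𝓝 (t + 0)) := tendsto_id.const_add t
      rw [add_zero] at this
      exact this.mono_left nhdsWithin_le_nhds
    · filter_upwards [self_mem_nhdsWithin] with h hh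
      exact lt_add_of_pos_right t hh
  have hs : Tendsto (fun h : ℝ => h⁻¹ • (u (t + h) - u t) - w) (𝓝[>] 0) (𝓝 0) := by
    have h1 := ((hasDerivWithinAt_iff_tendsto_slope' (s := Set.Ioi t) (by simp)).1
      (hu.mono Set.Ioi_subset_Ici_self)).comp hshift
    have h2 := h1.sub_const w
    rw [sub_self] at h2
    refine h2.congr fun h => ?_
    simp [slope, Function.comp]
  have herr : Tendsto (fun h : ℝ => K * ‖h⁻¹ • (u (t + h) - u t) - w‖) (𝓝[>] 0) (𝓝 0) := by
    simpa using hs.norm.const_mul K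
  have hdiff : Tendsto (fun h : ℝ => (N (u (t + h)) - N (u t)) / h
      - (N (u t + h • w) - N (u t)) / h) (𝓝[>] 0) (𝓝 0) := by
    refine squeeze_zero_norm' ?_ herr
    filter_upwards [self_mem_nhdsWithin] with h hh
    have hh' : 0 < h := hh
    have e : u (t + h) - (u t + h • w) = h • (h⁻¹ • (u (t + h) - u t) - w) := by
      rw [smul_sub, smul_smul, mul_inv_cancel₀ hh'.ne', one_smul]; abel
    rw [← sub_div, sub_sub_sub_cancel_right, Real.norm_eq_abs, abs_div, abs_of_pos hh',
      div_le_iff₀ hh']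
    calc |N (u (t + h)) - N (u t + h • w)|
        ≤ N (u (t + h) - (u t + h • w)) := abs_sub_map_le_sub N _ _
      _ = h * N (h⁻¹ • (u (t + h) - u t) - w) := by
        rw [e, map_smul_eq_mul, Real.norm_of_nonneg hh'.le]
      _ ≤ h * (K * ‖h⁻¹ • (u (t + h) - u t) - w‖) :=
        mul_le_mul_of_nonneg_left (hK _) hh'.le
      _ = _ := mul_comm _ _
  have := hdiff.add (tendsto_normDirDeriv N (u t) w)
  rw [zero_add] at this
  exact this.congr fun h => sub_add_cancel _ _

/-- The left derivative of the norm along a curve `u` that has a left derivative `w` is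
`-normDirDeriv N (u t) (-w)`. -/
theorem tendsto_norm_slope_left (N : Seminorm ℝ E) {u : ℝ → E} {w : E} {t : ℝ}
    (hu : HasDerivWithinAt u w (Set.Iic t) t) :
    Tendsto (fun h : ℝ => (N (u (t - h)) - N (u t)) / h) (𝓝[>] 0)
      (𝓝 (normDirDeriv N (u t) (-w))) := by
  have h1 : HasDerivWithinAt (fun s => u (-s)) (-w) (Set.Ici (-t)) (-t) := by
    have h2 : HasDerivWithinAt (fun s : ℝ => -s) (-1) (Set.Ici (-t)) (-t) :=
      (hasDerivAt_neg (-t)).hasDerivWithinAt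
    have h3 : HasDerivWithinAt u w (Set.Iic t) (-(-t)) := by rwa [_root_.neg_neg]
    have := h3.scomp (-t) h2 (fun s hs => by
      simp only [Set.mem_Ici] at hs
      simp only [Set.mem_Iic]; linarith)
    simpa [Function.comp_def] using this
  have := tendsto_norm_slope_right N h1
  simp only [_root_.neg_neg] at this
  refine this.congr fun h => ?_
  rw [show -(-t + h) = t - h by ring]

end FiniteDimensionalSeminorm

/-! ### Grönwall inequalities for one-sided derivatives of scalar functions -/

section Gronwall

/-- Grönwall's inequality for an upper right Dini derivative. -/
theorem le_exp_mul_of_upperRightDini_le {g : ℝ → ℝ} {b s t : ℝ} (hst : s ≤ t)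
    (hg : ContinuousOn g (Set.Icc s t))
    (hd : ∀ r ∈ Set.Ico s t, upperRightDini g r ≤ ((b * g r : ℝ) : EReal)) :
    g t ≤ Real.exp (b * (t - s)) * g s := by
  have := le_gronwallBound_of_liminf_deriv_right_le (f := g) (f' := fun r => b * g r)
    (δ := g s) (K := b) (ε := 0) hg ?_ le_rfl (fun x _ => by simp) t ⟨hst, le_rfl⟩
  · rwa [gronwallBound_ε0, mul_comm] at this
  · intro x hx r hr
    have h1 : upperRightDini g x < (r : EReal) :=
      (hd x hx).trans_lt (EReal.coe_lt_coe_iff.2 hr)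
    have h2 := eventually_lt_of_limsup_lt h1
    apply Eventually.frequently
    have hshift : Tendsto (fun z : ℝ => z - x) (𝓝[>] x) (𝓝[>] 0) := by
      refine tendsto_nhdsWithin_iff.2 ⟨?_, ?_⟩
      · have : Tendsto (fun z : ℝ => z - x) (𝓝 x) (𝓝 (x - x)) := tendsto_id.sub_const x
        rw [sub_self] at this
        exact this.mono_left nhdsWithin_le_nhds
      · filter_upwards [self_mem_nhdsWithin] with z hz
        exact Set.mem_Ioi.2 (sub_pos.2 (Set.mem_Ioi.1 hz))
    filter_upwards [hshift.eventually h2] with z hz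
    rw [EReal.coe_lt_coe_iff, add_sub_cancel] at hz
    rwa [inv_mul_eq_div]

theorem upperRightDini_eq_of_tendsto {g : ℝ → ℝ} {t d : ℝ}
    (h : Tendsto (fun h : ℝ => (g (t + h) - g t) / h) (𝓝[>] 0) (𝓝 d)) :
    upperRightDini g t = (d : EReal) :=
  ((continuous_coe_real_ereal.tendsto d).comp h).limsup_eq

/-- Grönwall's inequality for left derivatives: here `-d r` is the left derivative of `g` at
`r`. -/
theorem le_exp_mul_of_left_deriv_le {g d : ℝ → ℝ} {b s t : ℝ} (hst : s ≤ t)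
    (hg : ContinuousOn g (Set.Icc s t))
    (hd : ∀ r ∈ Set.Ioc s t, Tendsto (fun h : ℝ => (g (r - h) - g r) / h) (𝓝[>] 0) (𝓝 (d r)))
    (hb : ∀ r ∈ Set.Ioc s t, -d r ≤ b * g r) :
    g t ≤ Real.exp (b * (t - s)) * g s := by
  -- reversing time turns left derivatives into right derivatives
  have := le_exp_mul_of_upperRightDini_le (g := fun r => -g (-r)) (b := -b) (s := -t) (t := -s)
    (by linarith) ?_ ?_
  · simp only [_root_.neg_neg] at this
    have e : Real.exp (b * (t - s)) * Real.exp (-b * (-s - -t)) = 1 := by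
      rw [← Real.exp_add, ← Real.exp_zero]; congr 1; ring
    have h2 := mul_le_mul_of_nonneg_left this (Real.exp_pos (b * (t - s))).le
    rw [← mul_assoc, e] at h2
    linarith
  · refine (hg.comp continuousOn_neg fun r hr => ?_).neg
    exact ⟨by linarith [hr.2], by linarith [hr.1]⟩
  · intro r hr
    have hr' : -r ∈ Set.Ioc s t := ⟨by linarith [hr.2], by linarith [hr.1]⟩
    have h1 : Tendsto (fun h : ℝ => (-g (-(r + h)) - -g (-r)) / h) (𝓝[>] 0) (𝓝 (-d (-r))) := by
      refine (hd (-r) hr').neg.congr fun h => ?_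
      rw [show -(r + h) = -r - h by ring]; ring
    have h2 := hb (-r) hr'
    have h3 : -d (-r) ≤ -b * -g (-r) := by linarith
    exact (upperRightDini_eq_of_tendsto (g := fun r => -g (-r)) h1).trans_le
      (EReal.coe_le_coe_iff.2 h3)

end Gronwall

/-! ### Weak pairings and the conic matrix measure -/

section ConicMatrixMeasure

variable {n : ℕ}

theorem one_add_smul_mulVec (A : Matrix (Fin n) (Fin n) ℝ) (h : ℝ) (x : Fin n → ℝ) :
    (1 + h • A).mulVec x = x + h • A.mulVec x := by
  rw [Matrix.add_mulVec, Matrix.one_mulVec, Matrix.smul_mulVec]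

theorem DeimlingInequality.le_mul_normDirDeriv {N : Seminorm ℝ (Fin n → ℝ)}
    {W : (Fin n → ℝ) → (Fin n → ℝ) → ℝ} (hD : DeimlingInequality N W) (x y : Fin n → ℝ) :
    W x y ≤ N y * normDirDeriv N y x := by
  obtain ⟨d, hd, hle⟩ := hD x y
  rwa [tendsto_nhds_unique hd (tendsto_normDirDeriv N y x)] at hle

theorem IsWeakPairing.zero_left {W : (Fin n → ℝ) → (Fin n → ℝ) → ℝ} (hW : IsWeakPairing W)
    (y : Fin n → ℝ) : W 0 y = 0 := by
  simpa using hW.smul_left 0 0 y le_rfl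

theorem IsWeakPairing.le_mul {N : Seminorm ℝ (Fin n → ℝ)} {W : (Fin n → ℝ) → (Fin n → ℝ) → ℝ}
    (hW : IsWeakPairing W) (hNW : IsAssociatedPairing N W) (x y : Fin n → ℝ) :
    W x y ≤ N x * N y := by
  have h := (le_abs_self _).trans (hW.abs_le x y)
  rwa [← hNW, ← hNW, Real.sqrt_sq (apply_nonneg _ _), Real.sqrt_sq (apply_nonneg _ _)] at h

theorem normDirDeriv_mulVec_le (N : Seminorm ℝ (Fin n → ℝ)) (hN : ∀ x, N x = 0 → x = 0)
    (A : Matrix (Fin n) (Fin n) ℝ) {v : Fin n → ℝ} (hv : 0 ≤ v) :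
    normDirDeriv N v (A.mulVec v) ≤ conicMatrixMeasure N A * N v := by
  by_cases hv0 : v = 0
  · have := normDirDeriv_smul N 0 2 two_pos 0
    rw [smul_zero] at this
    simp only [hv0, Matrix.mulVec_zero, map_zero, mul_zero]
    linarith
  have hvp : 0 < N v := lt_of_le_of_ne (apply_nonneg _ _) fun h => hv0 (hN _ h.symm)
  obtain ⟨K, hK⟩ := exists_norm_mulVec_le N hN A
  refine le_of_tendsto_of_tendsto (tendsto_normDirDeriv N v (A.mulVec v))
    ((tendsto_conicQuotient N hN A).mul_const (N v)) ?_
  filter_upwards [self_mem_nhdsWithin] with h hh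
  have hh' : 0 < h := hh
  have hbdd : BddAbove (Set.range fun x : {x : Fin n → ℝ // 0 ≤ x ∧ x ≠ 0} =>
      (N ((1 + h • A).mulVec x.1) / N x.1 - 1) / h) := by
    refine ⟨K, ?_⟩
    rintro _ ⟨⟨x, hx, hx0⟩, rfl⟩
    have hxp : 0 < N x := lt_of_le_of_ne (apply_nonneg _ _) fun h => hx0 (hN _ h.symm)
    have h1 := map_add_le_add N x (h • A.mulVec x)
    rw [map_smul_eq_mul, Real.norm_of_nonneg hh'.le] at h1
    dsimp only
    rw [div_le_iff₀ hh', sub_le_iff_le_add, div_le_iff₀ hxp, one_add_smul_mulVec]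
    nlinarith [hK x]
  have h1 : (N ((1 + h • A).mulVec v) / N v - 1) / h ≤ conicQuotient N A h :=
    le_ciSup hbdd ⟨v, hv, hv0⟩
  rw [← one_add_smul_mulVec]
  calc (N ((1 + h • A).mulVec v) - N v) / h
      = (N ((1 + h • A).mulVec v) / N v - 1) / h * N v := by field_simp
    _ ≤ _ := mul_le_mul_of_nonneg_right h1 hvp.le

/-- For a Metzler matrix `A`, the matrix `1 + h A` is nonnegative for small `h > 0`. -/
theorem eventually_one_add_smul_nonneg {A : Matrix (Fin n) (Fin n) ℝ}
    (hA : ∀ i j, i ≠ j → 0 ≤ A i j) :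
    ∀ᶠ h : ℝ in 𝓝[>] 0, ∀ i j, 0 ≤ (1 + h • A) i j := by
  rw [eventually_all]; intro i
  rw [eventually_all]; intro j
  by_cases hij : i = j
  · subst hij
    have h1 : Tendsto (fun h : ℝ => 1 + h * A i i) (𝓝[>] 0) (𝓝 1) := by
      have : Tendsto (fun h : ℝ => 1 + h * A i i) (𝓝 0) (𝓝 (1 + 0 * A i i)) :=
        (tendsto_id.mul_const _).const_add 1
      rw [zero_mul, add_zero] at this
      exact this.mono_left nhdsWithin_le_nhds
    filter_upwards [h1.eventually (lt_mem_nhds zero_lt_one)] with h hh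
    simpa using hh.le
  · filter_upwards [self_mem_nhdsWithin] with h hh
    have hh' : 0 < h := hh
    simpa [hij] using mul_nonneg hh'.le (hA i j hij)

/-- If `A` is Metzler, a bound for the weak pairing `W (A v) v` on the nonnegative cone bounds the
conic matrix measure. The point is that `1 + h A` maps the cone to itself, so that the bound
applies to `z = (1 + h A) v`, while `(1 - h A) z` differs from `v` by a term of order `h ^ 2`. -/
theorem conicMatrixMeasure_le (hn : 0 < n) {N : Seminorm ℝ (Fin n → ℝ)}
    (hN : ∀ x, N x = 0 → x = 0) {W : (Fin n → ℝ) → (Fin n → ℝ) → ℝ} (hW : IsWeakPairing W)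
    (hNW : IsAssociatedPairing N W) {A : Matrix (Fin n) (Fin n) ℝ}
    (hA : ∀ i j, i ≠ j → 0 ≤ A i j) {b : ℝ}
    (hb : ∀ v, 0 ≤ v → W (A.mulVec v) v ≤ b * N v ^ 2) : conicMatrixMeasure N A ≤ b := by
  obtain ⟨K, hK⟩ := exists_norm_mulVec_le N hN (A * A)
  have hne : Nonempty {x : Fin n → ℝ // 0 ≤ x ∧ x ≠ 0} :=
    ⟨⟨1, zero_le_one, fun h => one_ne_zero (congrFun h ⟨0, hn⟩)⟩⟩
  have hlim : Tendsto (fun h : ℝ => (h * K + b) / (1 - h * b)) (𝓝[>] 0) (𝓝 b) := by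
    have : ContinuousAt (fun h : ℝ => (h * K + b) / (1 - h * b)) 0 :=
      ContinuousAt.div (by fun_prop) (by fun_prop) (by simp)
    have h2 := this.tendsto
    simp only [zero_mul, zero_add, sub_zero, div_one] at h2
    exact h2.mono_left nhdsWithin_le_nhds
  have hpos : ∀ᶠ h : ℝ in 𝓝[>] 0, 0 < 1 - h * b := by
    have : ContinuousAt (fun h : ℝ => 1 - h * b) 0 := by fun_prop
    exact (this.tendsto.mono_left nhdsWithin_le_nhds).eventually (lt_mem_nhds (by simp))
  refine le_of_tendsto_of_tendsto (tendsto_conicQuotient N hN A) hlim ?_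
  filter_upwards [self_mem_nhdsWithin, hpos, eventually_one_add_smul_nonneg hA] with h hh hhb hh0
  have hh' : 0 < h := hh
  refine ciSup_le fun ⟨v, hv, hv0⟩ => ?_
  dsimp only
  have hvp : 0 < N v := lt_of_le_of_ne (apply_nonneg _ _) fun h => hv0 (hN _ h.symm)
  set z := (1 + h • A).mulVec v with hz
  have hz0 : 0 ≤ z := by
    intro i
    simp only [hz, Matrix.mulVec, dotProduct]
    exact Finset.sum_nonneg fun j _ => mul_nonneg (hh0 i j) (hv j)
  have hzv : z - h • A.mulVec z = v - (h * h) • (A * A).mulVec v := by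
    rw [hz, one_add_smul_mulVec, Matrix.mulVec_add, Matrix.mulVec_smul, Matrix.mulVec_mulVec]
    module
  have h1 : (1 - h * b) * N z ≤ N (z - h • A.mulVec z) := by
    rcases (apply_nonneg N z).eq_or_lt with h0 | hzp
    · rw [← h0, mul_zero]; exact apply_nonneg _ _
    have h2 := hW.add_le (z - h • A.mulVec z) (h • A.mulVec z) z
    rw [sub_add_cancel, ← hNW, hW.smul_left h _ _ hh'.le] at h2
    have h3 := hW.le_mul hNW (z - h • A.mulVec z) z
    have h4 := mul_le_mul_of_nonneg_left (hb z hz0) hh'.le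
    refine le_of_mul_le_mul_right ?_ hzp
    linarith
  have h5 : N (z - h • A.mulVec z) ≤ N v + h * h * (K * N v) := by
    rw [hzv]
    refine (map_sub_le_add N _ _).trans ?_
    rw [map_smul_eq_mul, Real.norm_of_nonneg (by positivity)]
    have := mul_le_mul_of_nonneg_left (hK v) (mul_pos hh' hh').le
    linarith
  rw [div_le_iff₀ hh', sub_le_iff_le_add, div_le_iff₀ hvp, ← mul_le_mul_iff_right₀ hhb]
  calc (1 - h * b) * N z ≤ N v + h * h * (K * N v) := h1.trans h5
    _ = (1 - h * b) * (((h * K + b) / (1 - h * b) * h + 1) * N v) := by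
      field_simp
      ring

/-- For a Metzler matrix and a monotonic norm, `v` may be replaced by its componentwise absolute
value, so that the conic matrix measure controls all directions. -/
theorem IsMonotonicNorm.normDirDeriv_mulVec_le {N : Seminorm ℝ (Fin n → ℝ)}
    (hmon : IsMonotonicNorm N) (hN : ∀ x, N x = 0 → x = 0) {A : Matrix (Fin n) (Fin n) ℝ}
    (hA : ∀ i j, i ≠ j → 0 ≤ A i j) (v : Fin n → ℝ) :
    normDirDeriv N v (A.mulVec v) ≤ conicMatrixMeasure N A * N v := by
  have habs : N |v| = N v :=
    le_antisymm (hmon _ _ fun i => by simp) (hmon _ _ fun i => by simp)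
  rw [← habs]
  refine le_trans ?_ (_root_.normDirDeriv_mulVec_le N hN A (abs_nonneg v))
  refine le_of_tendsto_of_tendsto (tendsto_normDirDeriv N v (A.mulVec v))
    (tendsto_normDirDeriv N |v| (A.mulVec |v|)) ?_
  filter_upwards [self_mem_nhdsWithin, eventually_one_add_smul_nonneg hA] with h hh hh0
  have hh' : 0 < h := hh
  refine div_le_div_of_nonneg_right ?_ hh'.le
  rw [habs, ← one_add_smul_mulVec, ← one_add_smul_mulVec]
  refine sub_le_sub_right (hmon _ _ fun i => ?_) _
  refine le_trans ?_ (le_abs_self _)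
  simp only [Matrix.mulVec, dotProduct]
  refine (Finset.abs_sum_le_sum_abs _ _).trans (Finset.sum_le_sum fun j _ => ?_)
  rw [abs_mul, abs_of_nonneg (hh0 i j), Pi.abs_apply]

end ConicMatrixMeasure

/-! ### Jacobians of monotone systems and one-sided Lipschitz bounds -/

section VectorField

variable {n : ℕ} {f : ℝ → (Fin n → ℝ) → (Fin n → ℝ)} {C : Set (Fin n → ℝ)}
  {φ : ℝ → ℝ → (Fin n → ℝ) → (Fin n → ℝ)} {N : Seminorm ℝ (Fin n → ℝ)}
  {W : (Fin n → ℝ) → (Fin n → ℝ) → ℝ} {b : ℝ}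

theorem jacobianMatrix_mulVec (f : ℝ → (Fin n → ℝ) → (Fin n → ℝ)) (t : ℝ) (x v : Fin n → ℝ) :
    (jacobianMatrix f t x).mulVec v = fderiv ℝ (f t) x v := by
  rw [jacobianMatrix, LinearMap.toMatrix'_mulVec]; rfl

theorem jacobianMatrix_apply (f : ℝ → (Fin n → ℝ) → (Fin n → ℝ)) (t : ℝ) (x : Fin n → ℝ)
    (i j : Fin n) : jacobianMatrix f t x i j = fderiv ℝ (f t) x (Pi.single j 1) i := by
  rw [← jacobianMatrix_mulVec, Matrix.mulVec_single_one, Matrix.col_apply]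

/-- A closed set that contains the interior of a convex set with nonempty interior contains the
convex set. -/
theorem Convex.subset_of_interior_subset (hC : Convex ℝ C) (hint : (interior C).Nonempty)
    {S : Set (Fin n → ℝ)} (hS : IsClosed S) (h : interior C ⊆ S) : C ⊆ S :=
  subset_closure.trans
    ((hC.closure_interior_eq_closure_of_nonempty_interior hint).symm.trans_subset
      (closure_minimal h hS))

theorem continuous_fderiv_apply
    (hf_deriv : ContinuousOn (fun p : ℝ × (Fin n → ℝ) => fderiv ℝ (f p.1) p.2)
      (Set.Ici 0 ×ˢ Set.univ)) {t : ℝ} (ht : 0 ≤ t) (v : Fin n → ℝ) :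
    Continuous fun x => fderiv ℝ (f t) x v := by
  have h1 : Continuous fun x => fderiv ℝ (f t) x :=
    hf_deriv.comp_continuous (f := fun x => (t, x)) (by fun_prop) fun x => ⟨ht, trivial⟩
  exact h1.clm_apply continuous_const

theorem eventually_add_smul_mem {x : Fin n → ℝ} (hx : x ∈ interior C) (v : Fin n → ℝ) :
    ∀ᶠ h : ℝ in 𝓝[>] 0, x + h • v ∈ C := by
  have h1 : Tendsto (fun h : ℝ => x + h • v) (𝓝 0) (𝓝 x) := by
    have : Continuous fun h : ℝ => x + h • v := by fun_prop
    simpa using this.tendsto 0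
  exact (h1.mono_left nhdsWithin_le_nhds).eventually (mem_interior_iff_mem_nhds.1 hx)

/-- The Kamke condition, which is necessary for monotonicity. -/
theorem IsMonotoneFlowOn.apply_le_apply (hφ : IsFlowOn f C φ) (hmono : IsMonotoneFlowOn φ C)
    {t : ℝ} (ht : 0 ≤ t) {x y : Fin n → ℝ} (hx : x ∈ C) (hy : y ∈ C) (hxy : x ≤ y) {i : Fin n}
    (hi : x i = y i) : f t x i ≤ f t y i := by
  obtain ⟨hx0, hxd⟩ := hφ t ht x hx
  obtain ⟨hy0, hyd⟩ := hφ t ht y hy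
  have h1 := hasDerivWithinAt_pi.1 (hyd t le_rfl) i
  have h2 := hasDerivWithinAt_pi.1 (hxd t le_rfl) i
  have h3 := (hasDerivWithinAt_iff_tendsto_slope' (s := Set.Ioi t) (by simp)).1
    ((h1.sub h2).mono Set.Ioi_subset_Ici_self)
  rw [hx0, hy0] at h3
  refine sub_nonneg.1 (ge_of_tendsto h3 ?_)
  filter_upwards [self_mem_nhdsWithin] with s hs
  have hs' : t < s := hs
  have h4 := hmono t ht x hx y hy hxy s hs'.le i
  simp only [slope, vsub_eq_sub, Pi.sub_apply, hx0, hy0, hi, sub_self, sub_zero, smul_eq_mul]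
  exact mul_nonneg (inv_nonneg.2 (sub_nonneg.2 hs'.le)) (sub_nonneg.2 h4)

theorem jacobianMatrix_metzler (hf_diff : ∀ t, 0 ≤ t → Differentiable ℝ (f t))
    (hf_deriv : ContinuousOn (fun p : ℝ × (Fin n → ℝ) => fderiv ℝ (f p.1) p.2)
      (Set.Ici 0 ×ˢ Set.univ)) (hC : Convex ℝ C) (hint : (interior C).Nonempty)
    (hφ : IsFlowOn f C φ) (hmono : IsMonotoneFlowOn φ C) {t : ℝ} (ht : 0 ≤ t)
    {x : Fin n → ℝ} (hx : x ∈ C) {i j : Fin n} (hij : i ≠ j) : 0 ≤ jacobianMatrix f t x i j := by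
  have hS : IsClosed {x | 0 ≤ fderiv ℝ (f t) x (Pi.single j 1) i} :=
    isClosed_le continuous_const
      ((continuous_apply i).comp (continuous_fderiv_apply hf_deriv ht _))
  rw [jacobianMatrix_apply]
  refine hC.subset_of_interior_subset hint hS (fun x hx => ?_) hx
  have h1 := ((hf_diff t ht x).hasFDerivAt.hasLineDerivAt
    (Pi.single j 1)).tendsto_slope_zero_right
  refine ge_of_tendsto (((continuous_apply i).tendsto _).comp h1) ?_
  filter_upwards [self_mem_nhdsWithin, eventually_add_smul_mem hx (Pi.single j 1)] with h hh hhC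
  have hh' : 0 < h := hh
  have hle : x ≤ x + h • Pi.single j 1 :=
    le_add_of_nonneg_right (smul_nonneg hh'.le (Pi.single_nonneg.2 zero_le_one))
  have h2 := hmono.apply_le_apply hφ ht (interior_subset hx) hhC hle (i := i) (by simp [hij])
  exact mul_nonneg (inv_nonneg.2 hh'.le) (sub_nonneg.2 h2)

theorem ConicJacobianBound.orderedOneSidedLipschitz (hN : ∀ x, N x = 0 → x = 0)
    (hW : IsWeakPairing W) (hD : DeimlingInequality N W)
    (hf_diff : ∀ t, 0 ≤ t → Differentiable ℝ (f t)) (hC : Convex ℝ C)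
    (h : ConicJacobianBound N f C b) : OrderedOneSidedLipschitz N W f C b := by
  intro t ht x hx y hy hyx
  refine sublinear_sub_le_of_fderiv_le (q := fun w => W w (x - y))
    (fun c hc w => hW.smul_left c w _ hc.le) (fun w₁ w₂ => hW.add_le w₁ w₂ _) hC (hf_diff t ht)
    hx hy fun z hz => ?_
  have h1 := hD.le_mul_normDirDeriv (fderiv ℝ (f t) z (x - y)) (x - y)
  have h2 := normDirDeriv_mulVec_le N hN (jacobianMatrix f t z) (sub_nonneg.2 hyx)
  rw [jacobianMatrix_mulVec] at h2
  have h3 := mul_le_mul_of_nonneg_right (h t ht z hz) (apply_nonneg N (x - y))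
  calc W (fderiv ℝ (f t) z (x - y)) (x - y) ≤ N (x - y) * (b * N (x - y)) :=
        h1.trans (mul_le_mul_of_nonneg_left (h2.trans h3) (apply_nonneg _ _))
    _ = b * N (x - y) ^ 2 := by ring

theorem OrderedOneSidedLipschitz.pairing_fderiv_le (hW : IsWeakPairing W)
    (hf_diff : ∀ t, 0 ≤ t → Differentiable ℝ (f t))
    (hf_deriv : ContinuousOn (fun p : ℝ × (Fin n → ℝ) => fderiv ℝ (f p.1) p.2)
      (Set.Ici 0 ×ˢ Set.univ)) (hC : Convex ℝ C) (hint : (interior C).Nonempty)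
    (h : OrderedOneSidedLipschitz N W f C b) {t : ℝ} (ht : 0 ≤ t) {x v : Fin n → ℝ}
    (hx : x ∈ C) (hv : 0 ≤ v) : W (fderiv ℝ (f t) x v) v ≤ b * N v ^ 2 := by
  have hS : IsClosed {x | W (fderiv ℝ (f t) x v) v ≤ b * N v ^ 2} :=
    isClosed_le ((hW.continuous_left v).comp (continuous_fderiv_apply hf_deriv ht v))
      continuous_const
  refine hC.subset_of_interior_subset hint hS (fun x hx => ?_) hx
  have h1 := ((hf_diff t ht x).hasFDerivAt.hasLineDerivAt v).tendsto_slope_zero_right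
  refine le_of_tendsto (((hW.continuous_left v).tendsto _).comp h1) ?_
  filter_upwards [self_mem_nhdsWithin, eventually_add_smul_mem hx v] with r hr hrC
  have hr' : 0 < r := hr
  have h2 := h t ht (x + r • v) hrC x (interior_subset hx)
    (le_add_of_nonneg_right (smul_nonneg hr'.le hv))
  rw [add_sub_cancel_left, map_smul_eq_mul, Real.norm_of_nonneg hr'.le,
    hW.smul_right r _ _ hr'.le] at h2
  simp only [Function.comp]
  rw [hW.smul_left _ _ _ (inv_nonneg.2 hr'.le), inv_mul_le_iff₀ hr']
  refine le_of_mul_le_mul_left ?_ hr'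
  linarith

theorem OrderedOneSidedLipschitz.conicJacobianBound (hn : 0 < n) (hN : ∀ x, N x = 0 → x = 0)
    (hW : IsWeakPairing W) (hNW : IsAssociatedPairing N W)
    (hf_diff : ∀ t, 0 ≤ t → Differentiable ℝ (f t))
    (hf_deriv : ContinuousOn (fun p : ℝ × (Fin n → ℝ) => fderiv ℝ (f p.1) p.2)
      (Set.Ici 0 ×ˢ Set.univ)) (hC : Convex ℝ C) (hint : (interior C).Nonempty)
    (hφ : IsFlowOn f C φ) (hmono : IsMonotoneFlowOn φ C)
    (h : OrderedOneSidedLipschitz N W f C b) : ConicJacobianBound N f C b := by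
  intro t ht x hx
  refine conicMatrixMeasure_le hn hN hW hNW
    (fun i j hij => jacobianMatrix_metzler hf_diff hf_deriv hC hint hφ hmono ht hx hij)
    fun v hv => ?_
  rw [jacobianMatrix_mulVec]
  exact h.pairing_fderiv_le hW hf_diff hf_deriv hC hint ht hx hv

end VectorField

/-! ### Distances between trajectories -/

section Flow

variable {n : ℕ} {f : ℝ → (Fin n → ℝ) → (Fin n → ℝ)} {C : Set (Fin n → ℝ)}
  {φ : ℝ → ℝ → (Fin n → ℝ) → (Fin n → ℝ)} {N : Seminorm ℝ (Fin n → ℝ)}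
  {W : (Fin n → ℝ) → (Fin n → ℝ) → ℝ} {b : ℝ}

theorem IsFlowOn.continuousOn (hφ : IsFlowOn f C φ) {t₀ : ℝ} (h0 : 0 ≤ t₀) {x : Fin n → ℝ}
    (hx : x ∈ C) : ContinuousOn (fun s => φ s t₀ x) (Set.Ici t₀) :=
  fun t ht => ((hφ t₀ h0 x hx).2 t ht).continuousWithinAt

theorem IsFlowOn.tendsto_norm_sub_slope (hφ : IsFlowOn f C φ) (N : Seminorm ℝ (Fin n → ℝ))
    {t₀ t : ℝ} (h0 : 0 ≤ t₀) (ht : t₀ ≤ t) {x y : Fin n → ℝ} (hx : x ∈ C) (hy : y ∈ C) :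
    Tendsto (fun h : ℝ => (N (φ (t + h) t₀ x - φ (t + h) t₀ y)
      - N (φ t t₀ x - φ t t₀ y)) / h) (𝓝[>] 0)
      (𝓝 (normDirDeriv N (φ t t₀ x - φ t t₀ y) (f t (φ t t₀ x) - f t (φ t t₀ y)))) :=
  tendsto_norm_slope_right N (u := fun s => φ s t₀ x - φ s t₀ y)
    ((((hφ t₀ h0 x hx).2 t ht).sub ((hφ t₀ h0 y hy).2 t ht)).mono
      (Set.Ici_subset_Ici.2 ht))

/-- For a monotonic norm, the conic bound on the Jacobian bounds the growth rate of the distance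
of any two trajectories, ordered or not. -/
theorem ConicJacobianBound.upperRightDini_le (hmon : IsMonotonicNorm N)
    (hN : ∀ x, N x = 0 → x = 0) (hf_diff : ∀ t, 0 ≤ t → Differentiable ℝ (f t))
    (hf_deriv : ContinuousOn (fun p : ℝ × (Fin n → ℝ) => fderiv ℝ (f p.1) p.2)
      (Set.Ici 0 ×ˢ Set.univ)) (hC : Convex ℝ C) (hint : (interior C).Nonempty)
    (hφ : IsFlowOn f C φ) (hinv : IsForwardInvariantSet φ C) (hmono : IsMonotoneFlowOn φ C)
    (h : ConicJacobianBound N f C b) {t₀ t : ℝ} (h0 : 0 ≤ t₀) (ht : t₀ ≤ t) {x y : Fin n → ℝ}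
    (hx : x ∈ C) (hy : y ∈ C) :
    upperRightDini (fun s => N (φ s t₀ x - φ s t₀ y)) t
      ≤ ((b * N (φ t t₀ x - φ t t₀ y) : ℝ) : EReal) := by
  have ht0 : 0 ≤ t := h0.trans ht
  refine (upperRightDini_eq_of_tendsto (g := fun s => N (φ s t₀ x - φ s t₀ y))
    (hφ.tendsto_norm_sub_slope N h0 ht hx hy)).trans_le (EReal.coe_le_coe_iff.2 ?_)
  set v := φ t t₀ x - φ t t₀ y
  refine sublinear_sub_le_of_fderiv_le (q := normDirDeriv N v) (normDirDeriv_smul N v)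
    (normDirDeriv_add_le N v) hC (hf_diff t ht0) (hinv t₀ h0 x hx t ht) (hinv t₀ h0 y hy t ht)
    fun z hz => ?_
  have h1 := hmon.normDirDeriv_mulVec_le hN (A := jacobianMatrix f t z)
    (fun i j hij => jacobianMatrix_metzler hf_diff hf_deriv hC hint hφ hmono ht0 hz hij) v
  rw [jacobianMatrix_mulVec] at h1
  exact h1.trans (mul_le_mul_of_nonneg_right (h t ht0 z hz) (apply_nonneg N v))

/-- Incremental exponential stability at the initial time already gives the one-sided Lipschitz
condition. -/
theorem orderedOneSidedLipschitz_of_norm_flow_sub_le (hD : DeimlingInequality N W)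
    (hφ : IsFlowOn f C φ)
    (h : ∀ t₀, 0 ≤ t₀ → ∀ x₀ ∈ C, ∀ y₀ ∈ C, ∀ s t, t₀ ≤ s → s ≤ t →
      N (φ t t₀ x₀ - φ t t₀ y₀) ≤ Real.exp (b * (t - s)) * N (φ s t₀ x₀ - φ s t₀ y₀)) :
    OrderedOneSidedLipschitz N W f C b := by
  intro t ht x hx y hy _
  have h1 := hφ.tendsto_norm_sub_slope N ht le_rfl hx hy
  simp only [(hφ t ht x hx).1, (hφ t ht y hy).1] at h1
  have hexp : Tendsto (fun h : ℝ => (Real.exp (b * h) - 1) / h) (𝓝[>] 0) (𝓝 b) := by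
    have h2 : HasDerivAt (fun h : ℝ => Real.exp (b * h)) b 0 := by
      simpa using ((hasDerivAt_id (0 : ℝ)).const_mul b).exp
    refine h2.tendsto_slope_zero_right.congr fun h => ?_
    simp [inv_mul_eq_div]
  have h3 : normDirDeriv N (x - y) (f t x - f t y) ≤ b * N (x - y) := by
    refine le_of_tendsto_of_tendsto h1 (hexp.mul_const (N (x - y))) ?_
    filter_upwards [self_mem_nhdsWithin] with r hr
    have hr' : 0 < r := hr
    have h4 := h t ht x hx y hy t (t + r) le_rfl (by linarith)
    rw [(hφ t ht x hx).1, (hφ t ht y hy).1, add_sub_cancel_left] at h4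
    rw [div_mul_eq_mul_div]
    exact div_le_div_of_nonneg_right (by linarith) hr'.le
  calc W (f t x - f t y) (x - y) ≤ N (x - y) * (b * N (x - y)) :=
        (hD.le_mul_normDirDeriv _ _).trans (mul_le_mul_of_nonneg_left h3 (apply_nonneg _ _))
    _ = b * N (x - y) ^ 2 := by ring

/-- Ordered trajectories contract in any norm. Deimling's inequality bounds the weak pairing by the
directional derivative of the norm, not conversely; applied to the reversed direction it bounds
the left derivative of the distance from above. -/
theorem OrderedOneSidedLipschitz.norm_flow_sub_le
    (hW : IsWeakPairing W) (hD : DeimlingInequality N W) (hφ : IsFlowOn f C φ)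
    (hinv : IsForwardInvariantSet φ C) (hmono : IsMonotoneFlowOn φ C)
    (h : OrderedOneSidedLipschitz N W f C b) {s t : ℝ} (h0 : 0 ≤ s) (hst : s ≤ t)
    {x y : Fin n → ℝ} (hx : x ∈ C) (hy : y ∈ C) (hyx : y ≤ x) :
    N (φ t s x - φ t s y) ≤ Real.exp (b * (t - s)) * N (x - y) := by
  have hgron := le_exp_mul_of_left_deriv_le (g := fun r => N (φ r s x - φ r s y))
    (d := fun r => normDirDeriv N (φ r s x - φ r s y) (-(f r (φ r s x) - f r (φ r s y))))
    (b := b) hst ?_ ?_ ?_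
  · simpa only [(hφ s h0 x hx).1, (hφ s h0 y hy).1] using hgron
  · exact N.continuous_of_finiteDimensional.comp_continuousOn
      (((hφ.continuousOn h0 hx).sub (hφ.continuousOn h0 hy)).mono Set.Icc_subset_Ici_self)
  · intro r hr
    have h1 := (((hφ s h0 x hx).2 r hr.1.le).sub ((hφ s h0 y hy).2 r hr.1.le)).hasDerivAt
      (Ici_mem_nhds hr.1)
    exact tendsto_norm_slope_left N (u := fun r => φ r s x - φ r s y) h1.hasDerivWithinAt
  · intro r hr
    set u := φ r s x - φ r s y
    set w := f r (φ r s x) - f r (φ r s y)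
    rcases (apply_nonneg N u).eq_or_lt with hu | hu
    -- where the trajectories meet, the distance has a minimum
    · rw [← hu, mul_zero, neg_nonpos]
      refine ge_of_tendsto (tendsto_normDirDeriv N u (-w)) ?_
      filter_upwards [self_mem_nhdsWithin] with k hk
      have hk' : 0 < k := hk
      rw [← hu, sub_zero]
      exact div_nonneg (apply_nonneg _ _) hk'.le
    · have h1 : W w u ≤ b * N u ^ 2 := h r (h0.trans hr.1.le) _ (hinv s h0 x hx r hr.1.le) _
        (hinv s h0 y hy r hr.1.le) (hmono s h0 y hy x hx hyx r hr.1.le)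
      have h2 := hW.add_le w (-w) u
      rw [add_neg_cancel, hW.zero_left] at h2
      have h3 := hD.le_mul_normDirDeriv (-w) u
      refine le_of_mul_le_mul_left ?_ hu
      linarith

/-- The semigroup property of the flow on a compact convex set, by uniqueness of solutions. -/
theorem IsFlowOn.flow_flow (hf_diff : ∀ t, 0 ≤ t → Differentiable ℝ (f t))
    (hf_deriv : ContinuousOn (fun p : ℝ × (Fin n → ℝ) => fderiv ℝ (f p.1) p.2)
      (Set.Ici 0 ×ˢ Set.univ)) (hC : Convex ℝ C) (hCc : IsCompact C)
    (hφ : IsFlowOn f C φ) (hinv : IsForwardInvariantSet φ C) {t₀ s t : ℝ} (h0 : 0 ≤ t₀)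
    (hs : t₀ ≤ s) (hst : s ≤ t) {x : Fin n → ℝ} (hx : x ∈ C) :
    φ t s (φ s t₀ x) = φ t t₀ x := by
  have hs0 : 0 ≤ s := h0.trans hs
  have hxs := hinv t₀ h0 x hx s hs
  obtain ⟨L, hL⟩ := (isCompact_Icc.prod hCc).exists_bound_of_continuousOn
    (hf_deriv.mono (Set.prod_mono (s₁ := Set.Icc s t) (t₁ := C)
      (fun r hr => hs0.trans hr.1) (Set.subset_univ _)))
  have hlip : ∀ r ∈ Set.Ico s t, LipschitzOnWith L.toNNReal (f r) C := fun r hr =>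
    hC.lipschitzOnWith_of_nnnorm_fderiv_le (𝕜 := ℝ) (fun z _ => hf_diff r (hs0.trans hr.1) z)
      fun z hz => by
        rw [← NNReal.coe_le_coe, coe_nnnorm]
        exact (hL (r, z) ⟨⟨hr.1, hr.2.le⟩, hz⟩).trans (Real.le_coe_toNNReal L)
  refine ODE_solution_unique_of_mem_Icc_right (v := f) (s := fun _ => C)
    (f := fun r => φ r s (φ s t₀ x)) (g := fun r => φ r t₀ x) hlip ?_ ?_ ?_ ?_ ?_ ?_ ?_
    ⟨hst, le_rfl⟩
  · exact (hφ.continuousOn hs0 hxs).mono Set.Icc_subset_Ici_self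
  · exact fun r hr => ((hφ s hs0 _ hxs).2 r hr.1).mono (Set.Ici_subset_Ici.2 hr.1)
  · exact fun r hr => hinv s hs0 _ hxs r hr.1
  · exact (hφ.continuousOn h0 hx).mono fun r hr => hs.trans hr.1
  · exact fun r hr => ((hφ t₀ h0 x hx).2 r (hs.trans hr.1)).mono
      (Set.Ici_subset_Ici.2 (hs.trans hr.1))
  · exact fun r hr => hinv t₀ h0 x hx r (hs.trans hr.1)
  · exact (hφ s hs0 _ hxs).1

/-- Any two points are comparable with their infimum, at a distance bounded by a multiple of their
own distance. -/
theorem Seminorm.exists_sub_inf_le (N : Seminorm ℝ (Fin n → ℝ)) (hN : ∀ x, N x = 0 → x = 0) :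
    ∃ M, 0 < M ∧ ∀ x y, N (x - x ⊓ y) + N (y - x ⊓ y) ≤ M * N (x - y) := by
  obtain ⟨K, hK0, hK⟩ := N.exists_le_mul_norm
  obtain ⟨c, hc0, hc⟩ := N.exists_norm_le_mul hN
  have key : ∀ x y : Fin n → ℝ, ‖x - x ⊓ y‖ ≤ ‖x - y‖ := by
    intro x y
    refine (pi_norm_le_iff_of_nonneg (norm_nonneg _)).2 fun i => ?_
    refine le_trans ?_ (norm_le_pi_norm (x - y) i)
    simp only [Pi.sub_apply, Pi.inf_apply, Real.norm_eq_abs]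
    rcases le_total (x i) (y i) with h | h
    · simp [h]
    · simp [h]
  refine ⟨2 * (K * c), by positivity, fun x y => ?_⟩
  have h1 := (hK (x - x ⊓ y)).trans (mul_le_mul_of_nonneg_left (key x y) hK0.le)
  have h2 := (hK (y - x ⊓ y)).trans
    (mul_le_mul_of_nonneg_left (inf_comm x y ▸ key y x) hK0.le)
  rw [norm_sub_rev y x] at h2
  have h3 := mul_le_mul_of_nonneg_left (hc (x - y)) hK0.le
  linarith

end Flow

/-! ### The equivalences and the estimate on boxes -/

theorem mainTheorem1 {n : ℕ} (hn : 0 < n)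
    (N : Seminorm ℝ (Fin n → ℝ)) (hN : ∀ x, N x = 0 → x = 0)
    (W : (Fin n → ℝ) → (Fin n → ℝ) → ℝ) (hW : IsWeakPairing W)
    (hNW : IsAssociatedPairing N W) (hD : DeimlingInequality N W)
    (f : ℝ → (Fin n → ℝ) → (Fin n → ℝ))
    (hf : ContinuousOn (fun p : ℝ × (Fin n → ℝ) => f p.1 p.2) (Set.Ici 0 ×ˢ Set.univ))
    (hf_diff : ∀ t, 0 ≤ t → Differentiable ℝ (f t))
    (hf_deriv : ContinuousOn (fun p : ℝ × (Fin n → ℝ) => fderiv ℝ (f p.1) p.2)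
      (Set.Ici 0 ×ˢ Set.univ))
    (C : Set (Fin n → ℝ)) (hC : Convex ℝ C)
    (φ : ℝ → ℝ → (Fin n → ℝ) → (Fin n → ℝ)) (hφ : IsFlowOn f C φ)
    (hinv : IsForwardInvariantSet φ C) (hmono : IsMonotoneFlowOn φ C) (b : ℝ) :
    -- the equivalence for monotonic norms
    ((interior C).Nonempty → IsMonotonicNorm N →
      List.TFAE [
        ConicJacobianBound N f C b,
        OrderedOneSidedLipschitz N W f C b,
        ∀ t₀, 0 ≤ t₀ → ∀ x₀ ∈ C, ∀ y₀ ∈ C, ∀ t, t₀ ≤ t →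
          upperRightDini (fun s => N (φ s t₀ x₀ - φ s t₀ y₀)) t
            ≤ ((b * N (φ t t₀ x₀ - φ t t₀ y₀) : ℝ) : EReal),
        ∀ t₀, 0 ≤ t₀ → ∀ x₀ ∈ C, ∀ y₀ ∈ C, ∀ s t, t₀ ≤ s → s ≤ t →
          N (φ t t₀ x₀ - φ t t₀ y₀)
            ≤ Real.exp (b * (t - s)) * N (φ s t₀ x₀ - φ s t₀ y₀)]) ∧
    -- the equivalence for arbitrary norms
    ((interior C).Nonempty →
      (ConicJacobianBound N f C b ↔ OrderedOneSidedLipschitz N W f C b)) ∧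
    -- the consequence on boxes, for arbitrary norms
    (∀ xmin xmax : Fin n → ℝ, xmin < xmax → C = Set.Icc xmin xmax →
      (ConicJacobianBound N f C b ∨ OrderedOneSidedLipschitz N W f C b) →
      ∃ M : ℝ, 0 < M ∧
        ∀ t₀, 0 ≤ t₀ → ∀ x₀ ∈ C, ∀ y₀ ∈ C, ∀ s t, t₀ ≤ s → s ≤ t →
          N (φ t t₀ x₀ - φ t t₀ y₀)
            ≤ M * Real.exp (b * (t - s)) * N (φ s t₀ x₀ - φ s t₀ y₀)) := by
  have h12 : ConicJacobianBound N f C b → OrderedOneSidedLipschitz N W f C b :=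
    fun h => h.orderedOneSidedLipschitz hN hW hD hf_diff hC
  have h21 : (interior C).Nonempty → OrderedOneSidedLipschitz N W f C b →
      ConicJacobianBound N f C b :=
    fun hint h => h.conicJacobianBound hn hN hW hNW hf_diff hf_deriv hC hint hφ hmono
  refine ⟨fun hint hmon => ?_, fun hint => ⟨h12, h21 hint⟩, ?_⟩
  · tfae_have 1 → 2 := h12
    tfae_have 2 → 1 := h21 hint
    tfae_have 1 → 3 := fun h t₀ h0 x hx y hy t ht =>
      h.upperRightDini_le hmon hN hf_diff hf_deriv hC hint hφ hinv hmono h0 ht hx hy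
    tfae_have 3 → 4 := fun h t₀ h0 x hx y hy s t hs hst =>
      le_exp_mul_of_upperRightDini_le (g := fun s => N (φ s t₀ x - φ s t₀ y)) hst
        (N.continuous_of_finiteDimensional.comp_continuousOn
          (((hφ.continuousOn h0 hx).sub (hφ.continuousOn h0 hy)).mono
            fun r hr => hs.trans hr.1))
        fun r hr => h t₀ h0 x hx y hy r (hs.trans hr.1)
    tfae_have 4 → 2 := orderedOneSidedLipschitz_of_norm_flow_sub_le hD hφ
    tfae_finish
  · rintro xmin xmax - hbox h
    have h2 : OrderedOneSidedLipschitz N W f C b := h.elim h12 id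
    have hCc : IsCompact C := hbox ▸ isCompact_Icc
    obtain ⟨M, hM0, hM⟩ := N.exists_sub_inf_le hN
    refine ⟨M, hM0, fun t₀ h0 x hx y hy s t hs hst => ?_⟩
    have hs0 : 0 ≤ s := h0.trans hs
    -- restart the flow at time `s` and compare both trajectories with the one from the infimum
    rw [← hφ.flow_flow hf_diff hf_deriv hC hCc hinv h0 hs hst hx,
      ← hφ.flow_flow hf_diff hf_deriv hC hCc hinv h0 hs hst hy]
    have hX := hinv t₀ h0 x hx s hs
    have hY := hinv t₀ h0 y hy s hs
    set X := φ s t₀ x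
    set Y := φ s t₀ y
    have hZ : X ⊓ Y ∈ C := by
      rw [hbox] at hX hY ⊢
      exact ⟨le_inf hX.1 hY.1, inf_le_left.trans hX.2⟩
    have hXZ := h2.norm_flow_sub_le hW hD hφ hinv hmono hs0 hst hX hZ inf_le_left
    have hYZ := h2.norm_flow_sub_le hW hD hφ hinv hmono hs0 hst hY hZ inf_le_right
    have htri : N (φ t s X - φ t s Y)
        ≤ N (φ t s X - φ t s (X ⊓ Y)) + N (φ t s Y - φ t s (X ⊓ Y)) := by
      have := map_sub_le_add N (φ t s X - φ t s (X ⊓ Y)) (φ t s Y - φ t s (X ⊓ Y))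
      rwa [sub_sub_sub_cancel_right] at this
    have hexp := mul_le_mul_of_nonneg_left (hM X Y) (Real.exp_pos (b * (t - s))).le
    calc N (φ t s X - φ t s Y)
        ≤ Real.exp (b * (t - s)) * (N (X - X ⊓ Y) + N (Y - X ⊓ Y)) := by linarith
      _ ≤ Real.exp (b * (t - s)) * (M * N (X - Y)) := hexp
      _ = M * Real.exp (b * (t - s)) * N (X - Y) := by ring
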